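/- Let $b>1$ be an integer and let $A\subset\{0,1,\dots,b-1\}$ have cardinality $N$ with $1<N<b$. Put $N_1=\#(A\setminus\{0\})$, $\gamma_j=\sum_{a\in A}a^j$ and $\alpha_A(t)=\sum_{a\in A}e^{at}$. Call an integer $n>0$ admissible if all digits of its base-$b$ representation belong to $A$, and let $K(s)=\sum_{n>0,\ n\text{ admissible}}n^{-s}$, which converges for $\operatorname{Re}s>\log_bN$. Then $K$ has a meromorphic continuation to $\mathbb C$, again denoted $K$, which is analytic at the points $0,-1,-2,\dots$, and the following hold. (1) All the values $K(-m)$, $m\ge 0$, are rational, $K(0)=-N_1/(N-1)$, and for every $m\geq 1$ $$(b^{-m}-N)K(-m)=\frac{\gamma_m}{b^m}+\sum_{j=1}^m\binom mj\frac{\gamma_j}{b^j}K(-m+j).$$ (2) One has $0\in A$ if and only if $K(0)=-1$, and in that case $K(-m)=0$ for every $m\ge 1$. (3) One has $0\notin A$ if and only if $N_1=N$, if and only if $K(0)<-1$. In that case the exponential generating function $C(t)=\sum_{m\ge0}K(-m)\frac{t^m}{m!}$ satisfies, as a formal power series, $$C(b^{-1}t)=\alpha_A(b^{-1}t)+\alpha_A(b^{-1}t)\,C(t).$$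 It has a positive radius of convergence and extends to a meromorphic function $C$ on $\mathbb C$. At every point $t$ outside the set $P=\{b^jz:\ j\ge1,\ \alpha_A(z)=0\}$, the function $C$ is analytic, satisfies the same functional equation, and is given by $$C(t)=-1-\sum_{k=1}^\infty\frac1{\prod_{j=1}^k\alpha_A(b^{-j}t)},$$ where the series converges geometrically: there are $c>0$ and $0<q<1$ (depending on $t$) such that the $k$-th term is at most $cq^k$ in absolute value for all $k\ge1$. -/

import Mathlib

namespace RestrictedDirichlet

/-- `n` is admissible: every digit of its minimal base-`b` representation lies in `A`. -/
def IsAdmissible (b : ℕ) (A : Finset ℕ) (n : ℕ) : Prop :=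
  ∀ d ∈ Nat.digits b n, d ∈ A

/-- The coefficients of the restricted Dirichlet series: `1` on admissible integers, else `0`.
(The Dirichlet series `LSeries` ignores the coefficient with index `0`.) -/
noncomputable def coeff (b : ℕ) (A : Finset ℕ) : ℕ → ℂ :=
  Set.indicator {n : ℕ | IsAdmissible b A n} (fun _ => 1)

/-- `K` is the meromorphic function on `ℂ` continuing the restricted Dirichlet series
`∑' n ^ (-s)` (sum over the admissible `n > 0`) from the half-plane `re s > log_b (#A)`.
Normal form fixes the values of `K` everywhere: at each point that is not a pole `K` is analytic,
and at poles it has the conventional value `0`. -/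
structure IsContinuation (b : ℕ) (A : Finset ℕ) (K : ℂ → ℂ) : Prop where
  meromorphic : MeromorphicNFOn K Set.univ
  hasSum : ∀ s : ℂ, Real.logb b A.card < s.re → LSeriesHasSum (coeff b A) s (K s)

/-- The power sums `γ_j = ∑_{a ∈ A} a ^ j`. -/
noncomputable def powerSum (A : Finset ℕ) (j : ℕ) : ℂ := ∑ a ∈ A, (a : ℂ) ^ j

/-- `α_A(t) = ∑_{a ∈ A} exp (a t)`. -/
noncomputable def alpha (A : Finset ℕ) (t : ℂ) : ℂ := ∑ a ∈ A, Complex.exp (a * t)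

/-- The Taylor series of `α_A` at `0`, as a formal power series. -/
noncomputable def alphaSeries (A : Finset ℕ) : PowerSeries ℂ :=
  ∑ a ∈ A, PowerSeries.rescale (a : ℂ) (PowerSeries.exp ℂ)

/-- The exponential generating function `∑ K(-m) t ^ m / m!`, as a formal power series. -/
noncomputable def egf (K : ℂ → ℂ) : PowerSeries ℂ :=
  PowerSeries.mk fun m => K (-(m : ℂ)) / (m.factorial : ℂ)

/-- The set `{b ^ j z : j ≥ 1, α_A(z) = 0}`. -/
def exceptionalSet (b : ℕ) (A : Finset ℕ) : Set ℂ :=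
  {t | ∃ j : ℕ, 1 ≤ j ∧ ∃ z : ℂ, alpha A z = 0 ∧ t = (b : ℂ) ^ j * z}

/-- The term `1 / ∏_{j = 1}^k α_A(b ^ (-j) t)`. -/
noncomputable def term (b : ℕ) (A : Finset ℕ) (k : ℕ) (t : ℂ) : ℂ :=
  1 / ∏ j ∈ Finset.Icc 1 k, alpha A (t / (b : ℂ) ^ j)

end RestrictedDirichlet

/-!
An admissible integer with more than one digit is `q * b + a` with `q` admissible and `a ∈ A`.
Expanding `(q * b + a) ^ (-s)` by Newton's binomial series turns the Dirichlet series into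
`K s = digitSum A s + ∑ j, c_j(s) * K (s + j)`, where `c_0(s) = #A * b ^ (-s)`. Solving for `K s`
continues `K` to the left, strip by strip, with poles only where `c_0(s + k) = 1` for some `k ≥ 0`.

At `s = -m` the coefficients `c_j` vanish for `j > m`, which leaves the recurrence for the values
`K (-m)`. In terms of generating functions it reads `C(t / b) = E(t / b) + α_A(t / b) C(t)`, where
`E(t)` is the sum of `exp (a t)` over the nonzero `a ∈ A`; the formal solution is unique because
`b ^ (-m) ≠ #A`. If `0 ∈ A`, so that `E = α_A - 1`, it is the constant `-1`. If `0 ∉ A`, so that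
`E = α_A`, iterating `C(t) = -1 + C(t / b) / α_A(t / b)` produces the explicit series, which
converges because `α_A(b ^ (-j) t)` tends to `#A > 1`.
-/

namespace RestrictedDirichlet

open Filter Topology
open scoped ContDiff

section Induction

theorem forall_of_forall_add_natCast {P : ℂ → Prop} {σ : ℝ} (hright : ∀ s : ℂ, σ < s.re → P s)
    (hstep : ∀ s : ℂ, (∀ j : ℕ, P (s + (j + 1 : ℕ))) → P s) (s : ℂ) : P s := by
  obtain ⟨n, hn⟩ := exists_nat_gt (σ - s.re)
  induction n generalizing s with
  | zero => exact hright s (by simpa using hn)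
  | succ n ih =>
    refine hstep s fun j => ih _ ?_
    rw [Complex.add_re, Complex.natCast_re]
    push_cast at hn ⊢
    linarith [(Nat.cast_nonneg j : (0 : ℝ) ≤ j)]

theorem forall_of_eventually_of_forall_div {𝕜 : Type*} [NormedField 𝕜] {c : 𝕜} (hc : 1 < ‖c‖)
    {P : 𝕜 → Prop} (hzero : ∀ᶠ x in 𝓝 0, P x) (hstep : ∀ x, P (x / c) → P x) (x : 𝕜) : P x := by
  have hlim : Tendsto (fun n : ℕ => x * c⁻¹ ^ n) atTop (𝓝 0) := by
    have hinv : ‖c⁻¹‖ < 1 := by simpa only [norm_inv] using inv_lt_one_of_one_lt₀ hc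
    simpa only [mul_zero] using (tendsto_pow_atTop_nhds_zero_of_norm_lt_one hinv).const_mul x
  obtain ⟨n, hn⟩ := (hlim.eventually hzero).exists
  induction n with
  | zero => simpa using hn
  | succ n ih => exact ih (hstep _ (by rwa [div_eq_mul_inv, mul_assoc, ← pow_succ]))

end Induction

section Meromorphic

variable {𝕜 E : Type*} [NontriviallyNormedField 𝕜] [NormedAddCommGroup E] [NormedSpace 𝕜 E]
  {f g : 𝕜 → E} {U : Set 𝕜} {x : 𝕜}

theorem eqOn_of_meromorphicNFOn_of_eventuallyEq (hf : MeromorphicNFOn f U)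
    (hg : MeromorphicNFOn g U) (hU : IsPreconnected U) (hx : x ∈ U) (h : f =ᶠ[𝓝 x] g) :
    Set.EqOn f g U := by
  intro y hy
  have horder : meromorphicOrderAt (f - g) y = ⊤ := by
    by_contra hne
    refine (hf.meromorphicOn.sub hg.meromorphicOn).meromorphicOrderAt_ne_top_of_isPreconnected
      hU hy hx hne (meromorphicOrderAt_eq_top_iff.2 ?_)
    filter_upwards [h.filter_mono nhdsWithin_le_nhds] with z hz
    simp [hz]
  refine (((hf hy).eventuallyEq_nhdsNE_iff_eventuallyEq_nhds (hg hy)).1 ?_).eq_of_nhds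
  filter_upwards [meromorphicOrderAt_eq_top_iff.1 horder] with z hz
  exact sub_eq_zero.1 hz

theorem toMeromorphicNFOn_eventuallyEq_of_analyticAt (hf : MeromorphicOn f U) (hx : x ∈ U)
    (h : AnalyticAt 𝕜 f x) : toMeromorphicNFOn f U =ᶠ[𝓝 x] f := by
  simpa only [toMeromorphicNFAt_eq_self.2 h.meromorphicNFAt] using
    toMeromorphicNFOn_eq_toMeromorphicNFAt_on_nhds hf hx

end Meromorphic

section TaylorSeries

/-- The Taylor series of `f` at `0`, as a formal power series. It turns a functional equation
between functions analytic at `0` into one between formal power series. -/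
noncomputable def taylorSeries {𝕜 : Type*} [NontriviallyNormedField 𝕜] (f : 𝕜 → 𝕜) :
    PowerSeries 𝕜 :=
  PowerSeries.mk fun n => iteratedDeriv n f 0 / n.factorial

variable {𝕜 : Type*} [NontriviallyNormedField 𝕜] {f g : 𝕜 → 𝕜}

theorem taylorSeries_congr (h : f =ᶠ[𝓝 0] g) : taylorSeries f = taylorSeries g := by
  ext n
  simp only [taylorSeries, PowerSeries.coeff_mk, h.iteratedDeriv_eq]

theorem taylorSeries_add (hf : ContDiffAt 𝕜 ∞ f 0) (hg : ContDiffAt 𝕜 ∞ g 0) :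
    taylorSeries (fun t => f t + g t) = taylorSeries f + taylorSeries g := by
  ext n
  simp only [taylorSeries, PowerSeries.coeff_mk, map_add,
    iteratedDeriv_fun_add (hf.of_le (mod_cast le_top)) (hg.of_le (mod_cast le_top)), add_div]

theorem taylorSeries_mul [CharZero 𝕜] (hf : ContDiffAt 𝕜 ∞ f 0) (hg : ContDiffAt 𝕜 ∞ g 0) :
    taylorSeries (fun t => f t * g t) = taylorSeries f * taylorSeries g := by
  ext n
  rw [PowerSeries.coeff_mul, Finset.Nat.sum_antidiagonal_eq_sum_range_succ_mk]
  simp only [taylorSeries, PowerSeries.coeff_mk]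
  rw [iteratedDeriv_fun_mul (hf.of_le (mod_cast le_top)) (hg.of_le (mod_cast le_top)),
    Finset.sum_div]
  refine Finset.sum_congr rfl fun i hi => ?_
  rw [Nat.cast_choose 𝕜 (Finset.mem_range_succ_iff.1 hi)]
  have := Nat.cast_ne_zero (R := 𝕜).2 n.factorial_ne_zero
  field_simp

theorem iteratedDeriv_comp_mul_left (f : 𝕜 → 𝕜) (c : 𝕜) (n : ℕ) (x : 𝕜) :
    iteratedDeriv n (fun t => f (c * t)) x = c ^ n * iteratedDeriv n f (c * x) := by
  induction n generalizing x with
  | zero => simp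
  | succ n ih =>
    rw [iteratedDeriv_succ, funext ih, deriv_const_mul_field, deriv_comp_mul_left,
      ← iteratedDeriv_succ, smul_eq_mul]
    ring

theorem taylorSeries_comp_mul_left (f : 𝕜 → 𝕜) (c : 𝕜) :
    taylorSeries (fun t => f (c * t)) = PowerSeries.rescale c (taylorSeries f) := by
  ext n
  simp only [taylorSeries, PowerSeries.coeff_mk, PowerSeries.coeff_rescale,
    iteratedDeriv_comp_mul_left, mul_zero, mul_div_assoc]

theorem exists_hasSum_coeff_taylorSeries {f : ℂ → ℂ} (hf : AnalyticAt ℂ f 0) :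
    ∃ r : ℝ, 0 < r ∧ ∀ t : ℂ, ‖t‖ < r →
      HasSum (fun m : ℕ => PowerSeries.coeff m (taylorSeries f) * t ^ m) (f t) := by
  obtain ⟨r, hr, hball⟩ := hf.exists_ball_analyticOnNhd
  refine ⟨r, hr, fun t ht => ?_⟩
  have h := Complex.hasSum_taylorSeries_on_ball hball.differentiableOn (mem_ball_zero_iff.2 ht)
  refine h.congr_fun fun m => ?_
  simp only [taylorSeries, PowerSeries.coeff_mk, sub_zero, smul_eq_mul]
  ring

end TaylorSeries

theorem eq_of_rescale_eq_add_mul {R : Type*} [CommRing R] [IsDomain R] {c : R}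
    {E F F' G : PowerSeries R} (hc : ∀ m : ℕ, c ^ m ≠ PowerSeries.constantCoeff G)
    (hF : PowerSeries.rescale c F = E + G * F) (hF' : PowerSeries.rescale c F' = E + G * F') :
    F = F' := by
  have hsub : PowerSeries.rescale c (F - F') = G * (F - F') := by
    rw [map_sub, hF, hF']
    ring
  rw [← sub_eq_zero]
  ext m
  induction m using Nat.strong_induction_on with
  | _ m ih =>
    have h := congrArg (PowerSeries.coeff m) hsub
    rw [PowerSeries.coeff_rescale, PowerSeries.coeff_mul,
      Finset.sum_eq_single_of_mem (0, m) (by simp)] at h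
    · rw [PowerSeries.coeff_zero_eq_constantCoeff_apply, ← sub_eq_zero, ← sub_mul] at h
      exact (mul_eq_zero.1 h).resolve_left (sub_ne_zero.2 (hc m))
    · rintro ⟨i, j⟩ hij hne
      have hsum : i + j = m := by simpa using hij
      have hi : i ≠ 0 := fun hi => hne (by simp [hi, ← hsum])
      rw [ih j (by omega), map_zero, mul_zero]

section BinomialSeries

theorem choose_succ_eq_choose_mul_div {F : Type*} [Field F] [CharZero F] (a : F) (j : ℕ) :
    Ring.choose a (j + 1) = Ring.choose a j * ((a - j) / (j + 1)) := by
  have h := Ring.choose_smul_choose a j.le_succ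
  have hj : (j : F) + 1 ≠ 0 := by exact_mod_cast j.succ_ne_zero
  rw [Nat.choose_succ_self_right, Nat.succ_eq_add_one, Nat.add_sub_cancel_left,
    Ring.choose_one_right, nsmul_eq_mul, Nat.cast_succ] at h
  rw [← mul_div_assoc, ← h, mul_div_cancel_left₀ _ hj]

theorem differentiable_choose {𝕜 : Type*} [NontriviallyNormedField 𝕜] [CharZero 𝕜] (j : ℕ) :
    Differentiable 𝕜 fun a : 𝕜 => Ring.choose a j := by
  induction j with
  | zero => simp
  | succ j ih =>
    simp only [choose_succ_eq_choose_mul_div]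
    fun_prop

theorem norm_choose_le {a : ℂ} {R : ℝ} (ha : ‖a‖ ≤ R) (j : ℕ) :
    ‖Ring.choose a j‖ ≤ ‖Ring.choose (-(R : ℂ)) j‖ := by
  have hR : 0 ≤ R := (norm_nonneg a).trans ha
  induction j with
  | zero => simp
  | succ j ih =>
    have hfactor : ‖a - j‖ ≤ ‖-(R : ℂ) - j‖ := by
      calc ‖a - j‖ ≤ ‖a‖ + ‖(j : ℂ)‖ := norm_sub_le _ _
        _ ≤ R + j := by simpa using ha
        _ = ‖-(R : ℂ) - j‖ := by
          rw [← neg_add', norm_neg, ← Complex.ofReal_natCast, ← Complex.ofReal_add,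
            Complex.norm_of_nonneg (by positivity)]
    simp only [choose_succ_eq_choose_mul_div, norm_mul, norm_div]
    gcongr

theorem hasSum_choose_mul_pow (a : ℂ) {z : ℂ} (hz : ‖z‖ < 1) :
    HasSum (fun j : ℕ => Ring.choose a j * z ^ j) ((1 + z) ^ a) := by
  have h := (Complex.one_add_cpow_hasFPowerSeriesOnBall_zero (a := a)).hasSum (y := z)
    (by rwa [Metric.mem_eball, edist_zero_right, ← ofReal_norm, ENNReal.ofReal_lt_one])
  simpa [binomialSeries, smul_eq_mul, mul_comm] using h

theorem summable_norm_choose_mul_pow (a : ℂ) {x : ℝ} (hx : 0 ≤ x) (hx1 : x < 1) :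
    Summable fun j : ℕ => ‖Ring.choose a j‖ * x ^ j := by
  have h := (hasSum_choose_mul_pow a (z := x)
    (by simpa [abs_of_nonneg hx] using hx1)).summable.norm
  simpa [abs_of_nonneg hx] using h

theorem hasSum_choose_mul_pow_mul_cpow (a : ℂ) {x y : ℝ} (hx : 0 ≤ x) (hxy : x < y) :
    HasSum (fun j : ℕ => Ring.choose a j * (x : ℂ) ^ j * (y : ℂ) ^ (a - j))
      (((x : ℂ) + y) ^ a) := by
  have hy : 0 < y := hx.trans_lt hxy
  have hy0 : (y : ℂ) ≠ 0 := Complex.ofReal_ne_zero.2 hy.ne'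
  have hfactor : ((x : ℂ) + y) ^ a = (y : ℂ) ^ a * (1 + ((x / y : ℝ) : ℂ)) ^ a := by
    have hadd : (x : ℂ) + y = (y : ℂ) * ((1 + x / y : ℝ) : ℂ) := by
      push_cast
      field_simp
      ring
    rw [hadd, Complex.mul_cpow_ofReal_nonneg hy.le (by positivity), Complex.ofReal_add,
      Complex.ofReal_one]
  have hz : ‖((x / y : ℝ) : ℂ)‖ < 1 := by
    rwa [Complex.norm_of_nonneg (by positivity), div_lt_one hy]
  rw [hfactor]
  refine ((hasSum_choose_mul_pow a hz).mul_left ((y : ℂ) ^ a)).congr_fun fun j => ?_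
  rw [Complex.cpow_sub _ _ hy0, Complex.cpow_natCast, Complex.ofReal_div, div_pow]
  ring

end BinomialSeries

section Digits

theorem sum_range_mul {M : Type*} [AddCommMonoid M] (f : ℕ → M) (n b : ℕ) :
    ∑ k ∈ Finset.range (n * b), f k =
      ∑ q ∈ Finset.range n, ∑ a ∈ Finset.range b, f (q * b + a) := by
  induction n with
  | zero => simp
  | succ n ih => rw [Finset.sum_range_succ, ← ih, add_mul, one_mul, Finset.sum_range_add]

theorem summable_of_sum_range_mul_add_le {f : ℕ → ℝ} (hf : ∀ n, 0 ≤ f n) {b : ℕ} (hb : b ≠ 0)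
    {ρ : ℝ} (hρ : ρ < 1)
    (h : ∀ q ≠ 0, ∑ a ∈ Finset.range b, f (q * b + a) ≤ ρ * f q) : Summable f := by
  set E := ∑ a ∈ Finset.range b, f a
  refine summable_of_sum_range_le (c := (E - ρ * f 0) / (1 - ρ)) hf fun n => ?_
  rw [le_div_iff₀ (sub_pos.2 hρ)]
  have hmono {i j : ℕ} (hij : i ≤ j) : ∑ k ∈ Finset.range i, f k ≤ ∑ k ∈ Finset.range j, f k :=
    Finset.sum_le_sum_of_subset_of_nonneg (Finset.range_subset_range.2 hij) fun _ _ _ => hf _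
  have hsplit : ∑ k ∈ Finset.range (n + 1), f k ≤
      ρ * (∑ k ∈ Finset.range (n + 1), f k - f 0) + E := by
    calc ∑ k ∈ Finset.range (n + 1), f k
        ≤ ∑ k ∈ Finset.range ((n + 1) * b), f k :=
          hmono (Nat.le_mul_of_pos_right _ (Nat.pos_of_ne_zero hb))
      _ = ∑ q ∈ Finset.range n, ∑ a ∈ Finset.range b, f ((q + 1) * b + a) + E := by
          rw [sum_range_mul, Finset.sum_range_succ']
          simp only [zero_mul, zero_add, E]
      _ ≤ ∑ q ∈ Finset.range n, ρ * f (q + 1) + E := by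
          gcongr with q
          exact h (q + 1) q.succ_ne_zero
      _ = ρ * (∑ k ∈ Finset.range (n + 1), f k - f 0) + E := by
          rw [Finset.sum_range_succ', add_sub_cancel_right, Finset.mul_sum]
  nlinarith [hmono n.le_succ]

theorem tsum_eq_tsum_sum_range_mul_add {E : Type*} [NormedAddCommGroup E] [CompleteSpace E]
    {f : ℕ → E} (hf : Summable f) {b : ℕ} (hb : b ≠ 0) :
    ∑' n, f n = ∑' q, ∑ a ∈ Finset.range b, f (q * b + a) := by
  have : NeZero b := ⟨hb⟩
  have hprod : Summable fun p : ℕ × Fin b => f ((Nat.divModEquiv b).symm p) :=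
    (Nat.divModEquiv b).symm.summable_iff.2 hf
  rw [← (Nat.divModEquiv b).symm.tsum_eq, hprod.tsum_prod]
  simp only [tsum_fintype, Nat.divModEquiv_symm_apply,
    fun q => Fin.sum_univ_eq_sum_range (fun a => f (q * b + a)) b]

end Digits

variable {b : ℕ} {A : Finset ℕ}

section DirichletSeries

theorem isAdmissible_mul_add (hb : 1 < b) {q a : ℕ} (ha : a < b) (h : a ≠ 0 ∨ q ≠ 0) :
    IsAdmissible b A (q * b + a) ↔ a ∈ A ∧ IsAdmissible b A q := by
  rw [IsAdmissible, add_comm, mul_comm, Nat.digits_add b hb a q ha h, List.forall_mem_cons,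
    IsAdmissible]

theorem coeff_zero : coeff b A 0 = 1 := by
  simp [coeff, IsAdmissible]

theorem coeff_mul_add (hb : 1 < b) {q a : ℕ} (ha : a < b) (h : a ≠ 0 ∨ q ≠ 0) :
    coeff b A (q * b + a) = if a ∈ A then coeff b A q else 0 := by
  classical
  simp only [coeff, Set.indicator_apply, Set.mem_ofPred_eq, isAdmissible_mul_add hb ha h, ite_and]

/-- `∑ a ^ (-s)` over the nonzero digits `a`: the contribution to the restricted Dirichlet series
of the integers with a single digit. -/
noncomputable def digitSum (A : Finset ℕ) (s : ℂ) : ℂ := ∑ a ∈ A.erase 0, (a : ℂ) ^ (-s)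

/-- The coefficient of `K (s + j)` in the functional equation
`K s = digitSum A s + ∑' j, shiftCoeff b A s j * K (s + j)`. -/
noncomputable def shiftCoeff (b : ℕ) (A : Finset ℕ) (s : ℂ) (j : ℕ) : ℂ :=
  Ring.choose (-s) j * powerSum A j * (b : ℂ) ^ (-(s + j))

theorem sum_range_ite_mem {M : Type*} [AddCommMonoid M] (hA : ∀ a ∈ A, a < b) (f : ℕ → M) :
    ∑ a ∈ Finset.range b, (if a ∈ A then f a else 0) = ∑ a ∈ A, f a := by
  rw [Finset.sum_ite_mem, Finset.inter_eq_right.2 fun a ha => Finset.mem_range.2 (hA a ha)]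

theorem lseriesTerm_mul_add (hb : 1 < b) {q a : ℕ} (hq : q ≠ 0) (ha : a < b) (s : ℂ) :
    LSeries.term (coeff b A) s (q * b + a) =
      if a ∈ A then coeff b A q / ((q * b + a : ℕ) : ℂ) ^ s else 0 := by
  rw [LSeries.term_of_ne_zero (by positivity), coeff_mul_add hb ha (Or.inr hq), ite_div, zero_div]

theorem sum_range_lseriesTerm (hb : 1 < b) (hA : ∀ a ∈ A, a < b) (s : ℂ) :
    ∑ a ∈ Finset.range b, LSeries.term (coeff b A) s a = digitSum A s := by
  rw [digitSum, ← sum_range_ite_mem fun a ha => hA a (Finset.mem_of_mem_erase ha)]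
  refine Finset.sum_congr rfl fun a ha => ?_
  rcases eq_or_ne a 0 with rfl | ha0
  · simp
  · have hcoeff : coeff b A a = if a ∈ A then 1 else 0 := by
      simpa [coeff_zero] using coeff_mul_add (q := 0) hb (Finset.mem_range.1 ha) (Or.inl ha0)
    simp [hcoeff, ha0, Complex.cpow_neg, ite_div]

theorem norm_lseriesTerm_mul_add_le (hb : 1 < b) {q a : ℕ} (hq : q ≠ 0) (ha : a < b) {s : ℂ}
    (hs : 0 ≤ s.re) :
    ‖LSeries.term (coeff b A) s (q * b + a)‖ ≤
      if a ∈ A then (b : ℝ) ^ (-s.re) * ‖LSeries.term (coeff b A) s q‖ else 0 := by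
  rw [lseriesTerm_mul_add hb hq ha]
  split_ifs with haA
  · calc ‖coeff b A q / ((q * b + a : ℕ) : ℂ) ^ s‖
        = ‖coeff b A q‖ / ((q * b + a : ℕ) : ℝ) ^ s.re := by
          rw [norm_div, Complex.norm_natCast_cpow_of_pos (by positivity)]
      _ ≤ ‖coeff b A q‖ / ((q : ℝ) * b) ^ s.re := by
          gcongr
          exact_mod_cast Nat.le_add_right _ _
      _ = (b : ℝ) ^ (-s.re) * ‖LSeries.term (coeff b A) s q‖ := by
          rw [LSeries.norm_term_eq, if_neg hq, Real.mul_rpow (by positivity) (by positivity),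
            Real.rpow_neg (by positivity)]
          field_simp
  · rw [norm_zero]

theorem logb_card_nonneg (hA : A.Nonempty) (hb : 1 < b) : 0 ≤ Real.logb b A.card :=
  Real.logb_nonneg (by exact_mod_cast hb) (by exact_mod_cast hA.card_pos)

theorem card_mul_rpow_lt_one (hA : A.Nonempty) (hb : 1 < b) {σ : ℝ}
    (hσ : Real.logb b A.card < σ) : (A.card : ℝ) * (b : ℝ) ^ (-σ) < 1 := by
  rw [Real.rpow_neg b.cast_nonneg, ← div_eq_mul_inv, div_lt_one (by positivity)]
  exact (Real.logb_lt_iff_lt_rpow (by exact_mod_cast hb) (by exact_mod_cast hA.card_pos)).1 hσ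

theorem lseriesSummable_coeff (hA : ∀ a ∈ A, a < b) (hA0 : A.Nonempty) (hb : 1 < b) {s : ℂ}
    (hs : Real.logb b A.card < s.re) : LSeriesSummable (coeff b A) s := by
  refine Summable.of_norm (summable_of_sum_range_mul_add_le (fun _ => norm_nonneg _)
    (Nat.ne_zero_of_lt hb) (card_mul_rpow_lt_one hA0 hb hs) fun q hq => ?_)
  have hs0 : 0 ≤ s.re := (logb_card_nonneg hA0 hb).trans hs.le
  refine (Finset.sum_le_sum fun a ha =>
    norm_lseriesTerm_mul_add_le hb hq (Finset.mem_range.1 ha) hs0).trans_eq ?_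
  rw [sum_range_ite_mem hA (fun _ => _), Finset.sum_const, nsmul_eq_mul, mul_assoc]

theorem abscissaOfAbsConv_coeff_le (hA : ∀ a ∈ A, a < b) (hA0 : A.Nonempty) (hb : 1 < b) :
    LSeries.abscissaOfAbsConv (coeff b A) ≤ (Real.logb b A.card : ℝ) :=
  LSeries.abscissaOfAbsConv_le_of_forall_lt_LSeriesSummable fun _ hy =>
    lseriesSummable_coeff hA hA0 hb (by simpa using hy)

theorem norm_powerSum_le (hA : ∀ a ∈ A, a < b) (j : ℕ) :
    ‖powerSum A j‖ ≤ A.card * ((b : ℝ) - 1) ^ j := by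
  rw [powerSum, ← nsmul_eq_mul]
  refine (norm_sum_le _ _).trans (Finset.sum_le_card_nsmul _ _ _ fun a ha => ?_)
  have hab : (a : ℝ) + 1 ≤ b := by exact_mod_cast hA a ha
  rw [norm_pow, Complex.norm_natCast]
  gcongr
  linarith

theorem norm_natCast_cpow_neg_add_le (hb : 1 ≤ b) {s : ℂ} {R : ℝ} (hs : ‖s‖ ≤ R) (j : ℕ) :
    ‖(b : ℂ) ^ (-(s + j))‖ ≤ (b : ℝ) ^ R * ((b : ℝ) ^ j)⁻¹ := by
  have hb0 : (0 : ℝ) < b := by exact_mod_cast hb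
  rw [Complex.norm_natCast_cpow_of_pos hb, ← Real.rpow_natCast, ← Real.rpow_neg hb0.le,
    ← Real.rpow_add hb0]
  refine Real.rpow_le_rpow_of_exponent_le (by exact_mod_cast hb) ?_
  rw [Complex.neg_re, Complex.add_re, Complex.natCast_re]
  linarith [(abs_le.1 (Complex.abs_re_le_norm s)).1]

theorem exists_summable_norm_shiftCoeff_le (hA : ∀ a ∈ A, a < b) (hb : 1 ≤ b) (R : ℝ) :
    ∃ u : ℕ → ℝ, Summable u ∧ ∀ s : ℂ, ‖s‖ ≤ R → ∀ j, ‖shiftCoeff b A s j‖ ≤ u j := by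
  have hb1 : (1 : ℝ) ≤ b := by exact_mod_cast hb
  have hratio : 0 ≤ ((b : ℝ) - 1) / b := div_nonneg (by linarith) (by linarith)
  have hratio1 : ((b : ℝ) - 1) / b < 1 := by
    rw [div_lt_one (by linarith)]
    linarith
  refine ⟨_, (summable_norm_choose_mul_pow (-(R : ℂ)) hratio hratio1).mul_left
    (A.card * (b : ℝ) ^ R), fun s hs j => ?_⟩
  calc ‖shiftCoeff b A s j‖
      = ‖Ring.choose (-s) j‖ * ‖powerSum A j‖ * ‖(b : ℂ) ^ (-(s + j))‖ := by
        rw [shiftCoeff, norm_mul, norm_mul]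
    _ ≤ ‖Ring.choose (-(R : ℂ)) j‖ * (A.card * ((b : ℝ) - 1) ^ j) *
        ((b : ℝ) ^ R * ((b : ℝ) ^ j)⁻¹) := by
        gcongr
        · exact norm_choose_le (by rwa [norm_neg]) j
        · exact norm_powerSum_le hA j
        · exact norm_natCast_cpow_neg_add_le hb hs j
    _ = A.card * (b : ℝ) ^ R * (‖Ring.choose (-(R : ℂ)) j‖ * (((b : ℝ) - 1) / b) ^ j) := by
        rw [div_pow]
        ring

theorem summable_norm_shiftCoeff (hA : ∀ a ∈ A, a < b) (hb : 1 ≤ b) (s : ℂ) :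
    Summable fun j : ℕ => ‖shiftCoeff b A s j‖ :=
  have ⟨_, hu, hle⟩ := exists_summable_norm_shiftCoeff_le hA hb ‖s‖
  hu.of_nonneg_of_le (fun _ => norm_nonneg _) (hle s le_rfl)

theorem hasSum_shiftCoeff_mul_lseriesTerm (hA : ∀ a ∈ A, a < b) (hb : 1 < b) (s : ℂ) {q : ℕ}
    (hq : q ≠ 0) :
    HasSum (fun j : ℕ => shiftCoeff b A s j * LSeries.term (coeff b A) (s + j) q)
      (∑ a ∈ Finset.range b, LSeries.term (coeff b A) s (q * b + a)) := by
  have hterm (j : ℕ) : shiftCoeff b A s j * LSeries.term (coeff b A) (s + j) q =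
      ∑ a ∈ A, coeff b A q * (Ring.choose (-s) j * ((a : ℝ) : ℂ) ^ j *
        (((q * b : ℕ) : ℝ) : ℂ) ^ (-s - j)) := by
    rw [LSeries.term_of_ne_zero hq, shiftCoeff, powerSum, Finset.mul_sum, Finset.sum_mul,
      Finset.sum_mul, ← neg_add']
    refine Finset.sum_congr rfl fun a _ => ?_
    push_cast
    rw [Complex.natCast_mul_natCast_cpow, Complex.cpow_neg (q : ℂ)]
    ring
  simp only [hterm]
  rw [Finset.sum_congr rfl fun a ha => lseriesTerm_mul_add hb hq (Finset.mem_range.1 ha) s,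
    sum_range_ite_mem hA fun a => coeff b A q / ((q * b + a : ℕ) : ℂ) ^ s]
  refine hasSum_sum fun a ha => ?_
  have hlt : a < q * b := (hA a ha).trans_le (Nat.le_mul_of_pos_left b (Nat.pos_of_ne_zero hq))
  have h := (hasSum_choose_mul_pow_mul_cpow (-s) (a.cast_nonneg (α := ℝ))
    (Nat.cast_lt.2 hlt)).mul_left (coeff b A q)
  rwa [← Complex.ofReal_add, ← Nat.cast_add, add_comm a, Complex.ofReal_natCast,
    Complex.cpow_neg, ← div_eq_mul_inv] at h

theorem summable_shiftCoeff_mul_lseriesTerm (hA : ∀ a ∈ A, a < b) (hb : 1 ≤ b) {s : ℂ}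
    (hs : LSeriesSummable (coeff b A) s) :
    Summable (Function.uncurry fun j q : ℕ =>
      shiftCoeff b A s j * LSeries.term (coeff b A) (s + j) q) := by
  refine Summable.of_norm_bounded ((summable_norm_shiftCoeff hA hb s).mul_of_nonneg hs.norm
    (fun _ => norm_nonneg _) fun _ => norm_nonneg _) fun p => ?_
  rw [Function.uncurry, norm_mul]
  gcongr
  exact LSeries.norm_term_le_of_re_le_re _ (by simp) _

theorem lseries_coeff_eq (hA : ∀ a ∈ A, a < b) (hb : 1 < b) {s : ℂ}
    (hs : LSeriesSummable (coeff b A) s) :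
    LSeries (coeff b A) s = digitSum A s +
      ∑' j : ℕ, shiftCoeff b A s j * LSeries (coeff b A) (s + j) := by
  set F : ℕ → ℕ → ℂ := fun j q => shiftCoeff b A s j * LSeries.term (coeff b A) (s + j) q
  have hF : Summable (Function.uncurry F) := summable_shiftCoeff_mul_lseriesTerm hA hb.le hs
  have hsum : Summable fun q => ∑' j, F j q := hF.prod_symm.prod
  have hdigits (q : ℕ) : ∑ a ∈ Finset.range b, LSeries.term (coeff b A) s (q * b + a) =
      (if q = 0 then digitSum A s else 0) + ∑' j, F j q := by
    rcases eq_or_ne q 0 with rfl | hq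
    · simp [F, sum_range_lseriesTerm hb hA]
    · rw [if_neg hq, zero_add, (hasSum_shiftCoeff_mul_lseriesTerm hA hb s hq).tsum_eq]
  calc LSeries (coeff b A) s
      = ∑' q, ((if q = 0 then digitSum A s else 0) + ∑' j, F j q) := by
        rw [LSeries, tsum_eq_tsum_sum_range_mul_add hs (Nat.ne_zero_of_lt hb)]
        exact tsum_congr hdigits
    _ = digitSum A s + ∑' q, ∑' j, F j q := by
        rw [Summable.tsum_add (hasSum_ite_eq 0 _).summable hsum, tsum_ite_eq]
    _ = digitSum A s + ∑' j : ℕ, shiftCoeff b A s j * LSeries (coeff b A) (s + j) := by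
        rw [hF.tsum_comm]
        simp only [F, tsum_mul_left, LSeries]

end DirichletSeries

section Continuation

/-- The analytic continuation of the restricted Dirichlet series, computed by moving `s` to the
right through the functional equation until the series converges. At a zero of
`1 - #A * b ^ (-s)` its value is meaningless. -/
noncomputable def continuation (b : ℕ) (A : Finset ℕ) (s : ℂ) : ℂ :=
  if Real.logb b A.card < s.re then LSeries (coeff b A) s
  else (1 - A.card * (b : ℂ) ^ (-s))⁻¹ *
    (digitSum A s + ∑' j : ℕ, shiftCoeff b A s (j + 1) * continuation b A (s + (j + 1 : ℕ)))
termination_by ⌊Real.logb b A.card + 1 - s.re⌋₊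
decreasing_by
  rename_i hs
  have hle : Real.logb b A.card + 1 - (s + (j + 1 : ℕ)).re ≤ Real.logb b A.card - s.re := by
    rw [Complex.add_re, Complex.natCast_re, Nat.cast_succ]
    linarith [j.cast_nonneg (α := ℝ)]
  have hfloor : ⌊Real.logb b A.card + 1 - s.re⌋₊ = ⌊Real.logb b A.card - s.re⌋₊ + 1 := by
    rw [← Nat.floor_add_one (by linarith), add_sub_right_comm]
  exact (Nat.floor_le_floor hle).trans_lt (hfloor ▸ Nat.lt_succ_self _)

theorem continuation_of_lt {s : ℂ} (hs : Real.logb b A.card < s.re) :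
    continuation b A s = LSeries (coeff b A) s := by
  rw [continuation, if_pos hs]

theorem eventually_lt_re {σ : ℝ} {s : ℂ} (hs : σ < s.re) : ∀ᶠ z : ℂ in 𝓝 s, σ < z.re :=
  Complex.continuous_re.continuousAt.eventually_const_lt hs

theorem analyticAt_continuation_of_lt (hA : ∀ a ∈ A, a < b) (hA0 : A.Nonempty) (hb : 1 < b)
    {s : ℂ} (hs : Real.logb b A.card < s.re) : AnalyticAt ℂ (continuation b A) s := by
  have hlt : LSeries.abscissaOfAbsConv (coeff b A) < (s.re : EReal) :=
    (abscissaOfAbsConv_coeff_le hA hA0 hb).trans_lt (EReal.coe_lt_coe_iff.2 hs)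
  refine (LSeries_analyticOnNhd (coeff b A) s hlt).congr ?_
  filter_upwards [eventually_lt_re hs] with z hz
  exact (continuation_of_lt hz).symm

theorem norm_lseries_le_tsum {f : ℕ → ℂ} {s s' : ℂ} (hs : LSeriesSummable f s)
    (hle : s.re ≤ s'.re) : ‖LSeries f s'‖ ≤ ∑' n, ‖LSeries.term f s n‖ :=
  have hs' : LSeriesSummable f s' := hs.of_re_le_re hle
  (norm_tsum_le_tsum_norm hs'.norm).trans
    (hs'.norm.tsum_le_tsum (LSeries.norm_term_le_of_re_le_re f hle) hs.norm)

theorem exists_summable_norm_shiftCoeff_mul_continuation_le (hA : ∀ a ∈ A, a < b)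
    (hA0 : A.Nonempty) (hb : 1 < b) {σ : ℝ} (hσ : Real.logb b A.card < σ) (R : ℝ) (J : ℕ) :
    ∃ u : ℕ → ℝ, Summable u ∧ ∀ s : ℂ, ‖s‖ ≤ R → σ < s.re + J → ∀ j : ℕ,
      ‖shiftCoeff b A s (j + J) * continuation b A (s + (j + J : ℕ))‖ ≤ u j := by
  obtain ⟨u, hu, hle⟩ := exists_summable_norm_shiftCoeff_le hA hb.le R
  refine ⟨_, ((summable_nat_add_iff J).2 hu).mul_right
    (∑' n, ‖LSeries.term (coeff b A) (σ : ℂ) n‖), fun s hs hre j => ?_⟩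
  have hright : σ < (s + (j + J : ℕ)).re := by
    rw [Complex.add_re, Complex.natCast_re, Nat.cast_add]
    linarith [j.cast_nonneg (α := ℝ)]
  rw [norm_mul, continuation_of_lt (hσ.trans hright)]
  gcongr
  · exact (norm_nonneg _).trans (hle s hs _)
  · exact hle s hs _
  · exact norm_lseries_le_tsum (lseriesSummable_coeff hA hA0 hb (by simpa))
      (by simpa using hright.le)

theorem summable_shiftCoeff_mul_continuation (hA : ∀ a ∈ A, a < b) (hA0 : A.Nonempty)
    (hb : 1 < b) (s : ℂ) :
    Summable fun j : ℕ => shiftCoeff b A s j * continuation b A (s + j) := by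
  obtain ⟨J, hJ⟩ := exists_nat_gt (Real.logb b A.card + 1 - s.re)
  obtain ⟨u, hu, hle⟩ := exists_summable_norm_shiftCoeff_mul_continuation_le hA hA0 hb
    (lt_add_one _) ‖s‖ J
  exact (summable_nat_add_iff J).1
    (Summable.of_norm_bounded hu (hle s le_rfl (by linarith)))

theorem differentiable_shiftCoeff (hb : b ≠ 0) (j : ℕ) :
    Differentiable ℂ fun s => shiftCoeff b A s j :=
  (((differentiable_choose (𝕜 := ℂ) j).fun_comp differentiable_neg).mul_const _).mul
    ((by fun_prop : Differentiable ℂ fun s : ℂ => -(s + j)).const_cpow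
      (Or.inl (Nat.cast_ne_zero.2 hb)))

theorem differentiable_digitSum : Differentiable ℂ (digitSum A) :=
  Differentiable.fun_sum fun _ ha =>
    differentiable_neg.const_cpow (Or.inl (Nat.cast_ne_zero.2 (Finset.ne_of_mem_erase ha)))

theorem differentiable_one_sub_card_mul_cpow (hb : b ≠ 0) :
    Differentiable ℂ fun s : ℂ => 1 - (A.card : ℂ) * (b : ℂ) ^ (-s) :=
  ((differentiable_neg.const_cpow (Or.inl (Nat.cast_ne_zero.2 hb))).const_mul _).const_sub 1

theorem analyticAt_tsum_shiftCoeff_mul_continuation (hA : ∀ a ∈ A, a < b) (hA0 : A.Nonempty)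
    (hb : 1 < b) {s₀ : ℂ} {J : ℕ} (hJ : Real.logb b A.card < s₀.re + J) :
    AnalyticAt ℂ (fun s => ∑' j : ℕ,
      shiftCoeff b A s (j + J) * continuation b A (s + (j + J : ℕ))) s₀ := by
  obtain ⟨σ, hσ, hσJ⟩ := exists_between hJ
  obtain ⟨u, hu, hle⟩ := exists_summable_norm_shiftCoeff_mul_continuation_le hA hA0 hb hσ
    (‖s₀‖ + 1) J
  set U := Metric.ball s₀ 1 ∩ {s : ℂ | σ < s.re + J}
  have hU : IsOpen U := Metric.isOpen_ball.inter
    (isOpen_lt continuous_const (Complex.continuous_re.add continuous_const))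
  refine DifferentiableOn.analyticAt (s := U)
    (Complex.differentiableOn_tsum_of_summable_norm hu (fun j s hs => ?_) hU fun j s hs =>
      hle s ?_ hs.2 j) (hU.mem_nhds ⟨Metric.mem_ball_self one_pos, hσJ⟩)
  · have hright : Real.logb b A.card < (s + (j + J : ℕ)).re := by
      have := hs.2
      rw [Set.mem_ofPred_eq] at this
      rw [Complex.add_re, Complex.natCast_re, Nat.cast_add]
      linarith [j.cast_nonneg (α := ℝ)]
    exact ((differentiable_shiftCoeff (Nat.ne_zero_of_lt hb) _ s).mul
      ((analyticAt_continuation_of_lt hA hA0 hb hright).differentiableAt.comp s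
        (by fun_prop))).differentiableWithinAt
  · linarith [mem_ball_iff_norm.1 hs.1, norm_sub_norm_le s s₀]

theorem one_sub_card_mul_cpow_ne_zero (hA0 : A.Nonempty) (hb : 1 < b) {s : ℂ}
    (hs : Real.logb b A.card < s.re) : 1 - (A.card : ℂ) * (b : ℂ) ^ (-s) ≠ 0 := by
  refine sub_ne_zero.2 fun h => (card_mul_rpow_lt_one hA0 hb hs).ne ?_
  rw [← norm_one (α := ℂ), h, norm_mul, Complex.norm_natCast,
    Complex.norm_natCast_cpow_of_pos (by positivity), Complex.neg_re]

theorem one_sub_card_mul_cpow_intCast_ne_zero (hN : 1 < A.card) (hNb : A.card < b) (m : ℤ) :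
    1 - (A.card : ℂ) * (b : ℂ) ^ (-(m : ℂ)) ≠ 0 := by
  have hb : 1 < b := hN.trans hNb
  have hb0 : (b : ℂ) ≠ 0 := Nat.cast_ne_zero.2 (by positivity)
  intro h
  rw [Complex.cpow_neg, Complex.cpow_intCast, sub_eq_zero, ← div_eq_mul_inv,
    eq_div_iff (zpow_ne_zero _ hb0), one_mul] at h
  have hpow : (b : ℝ) ^ m = A.card := by simpa using congrArg norm h
  have hb1 : (1 : ℝ) < b := by exact_mod_cast hb
  have hm0 : 0 < m := (one_lt_zpow_iff_right₀ hb1).1 (hpow ▸ by exact_mod_cast hN)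
  have hm1 : m < 1 := (zpow_lt_zpow_iff_right₀ hb1).1
    (by rw [hpow, zpow_one]; exact_mod_cast hNb)
  omega

theorem shiftCoeff_zero (s : ℂ) : shiftCoeff b A s 0 = A.card * (b : ℂ) ^ (-s) := by
  simp [shiftCoeff, powerSum]

theorem continuation_eq (hA : ∀ a ∈ A, a < b) (hA0 : A.Nonempty) (hb : 1 < b) (s : ℂ) :
    continuation b A s = (1 - A.card * (b : ℂ) ^ (-s))⁻¹ *
      (digitSum A s +
        ∑' j : ℕ, shiftCoeff b A s (j + 1) * continuation b A (s + (j + 1 : ℕ))) := by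
  by_cases hs : Real.logb b A.card < s.re
  · have hright (j : ℕ) : LSeries (coeff b A) (s + j) = continuation b A (s + j) :=
      (continuation_of_lt (hs.trans_le (by simp))).symm
    have h := lseries_coeff_eq hA hb (lseriesSummable_coeff hA hA0 hb hs)
    simp only [hright] at h
    rw [(summable_shiftCoeff_mul_continuation hA hA0 hb s).tsum_eq_zero_add, shiftCoeff_zero,
      Nat.cast_zero, add_zero, ← continuation_of_lt hs] at h
    rw [eq_inv_mul_iff_mul_eq₀ (one_sub_card_mul_cpow_ne_zero hA0 hb hs)]
    linear_combination h
  · rw [continuation, if_neg hs]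

theorem continuation_eq_sum_add_tsum (hA : ∀ a ∈ A, a < b) (hA0 : A.Nonempty) (hb : 1 < b)
    (s : ℂ) (J : ℕ) :
    continuation b A s = (1 - (A.card : ℂ) * (b : ℂ) ^ (-s))⁻¹ * (digitSum A s +
      (∑ j ∈ Finset.range J, shiftCoeff b A s (j + 1) * continuation b A (s + (j + 1 : ℕ)) +
        ∑' j : ℕ, shiftCoeff b A s (j + (J + 1)) * continuation b A (s + (j + (J + 1) : ℕ)))) := by
  rw [continuation_eq hA hA0 hb s, ← ((summable_nat_add_iff 1).2
    (summable_shiftCoeff_mul_continuation hA hA0 hb s)).sum_add_tsum_nat_add J]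
  simp only [add_assoc]

theorem exists_continuation_eq (hA : ∀ a ∈ A, a < b) (hA0 : A.Nonempty) (hb : 1 < b) (s₀ : ℂ) :
    ∃ (J : ℕ) (T : ℂ → ℂ), AnalyticAt ℂ T s₀ ∧ continuation b A = fun s =>
      (1 - (A.card : ℂ) * (b : ℂ) ^ (-s))⁻¹ * (digitSum A s +
        (∑ j ∈ Finset.range J, shiftCoeff b A s (j + 1) * continuation b A (s + (j + 1 : ℕ)) +
          T s)) := by
  obtain ⟨J, hJ⟩ := exists_nat_gt (Real.logb b A.card - s₀.re)
  refine ⟨J, _, analyticAt_tsum_shiftCoeff_mul_continuation hA hA0 hb (J := J + 1) ?_,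
    funext fun s => continuation_eq_sum_add_tsum hA hA0 hb s J⟩
  push_cast
  linarith

theorem meromorphicAt_continuation (hA : ∀ a ∈ A, a < b) (hA0 : A.Nonempty) (hb : 1 < b)
    (s : ℂ) : MeromorphicAt (continuation b A) s := by
  induction s using forall_of_forall_add_natCast (σ := Real.logb b A.card) with
  | hright s hs => exact (analyticAt_continuation_of_lt hA hA0 hb hs).meromorphicAt
  | hstep s ih =>
    have hb0 : b ≠ 0 := Nat.ne_zero_of_lt hb
    obtain ⟨J, T, hT, heq⟩ := exists_continuation_eq hA hA0 hb s
    rw [heq]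
    refine ((differentiable_one_sub_card_mul_cpow hb0).analyticAt s).meromorphicAt.inv.mul
      ((differentiable_digitSum.analyticAt s).meromorphicAt.add
        ((MeromorphicAt.fun_sum fun j _ => ?_).add hT.meromorphicAt))
    exact ((differentiable_shiftCoeff hb0 _).analyticAt s).meromorphicAt.mul
      (MeromorphicAt.comp_analyticAt (g := fun s : ℂ => s + (j + 1 : ℕ)) (ih j) (by fun_prop))

theorem analyticAt_continuation (hA : ∀ a ∈ A, a < b) (hA0 : A.Nonempty) (hb : 1 < b) (s : ℂ)
    (hs : ∀ k : ℕ, 1 - (A.card : ℂ) * (b : ℂ) ^ (-(s + k)) ≠ 0) :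
    AnalyticAt ℂ (continuation b A) s := by
  induction s using forall_of_forall_add_natCast (σ := Real.logb b A.card) with
  | hright s hre => exact analyticAt_continuation_of_lt hA hA0 hb hre
  | hstep s ih =>
    have hb0 : b ≠ 0 := Nat.ne_zero_of_lt hb
    obtain ⟨J, T, hT, heq⟩ := exists_continuation_eq hA hA0 hb s
    rw [heq]
    refine (((differentiable_one_sub_card_mul_cpow hb0).analyticAt s).inv (by simpa using hs 0)).mul
      ((differentiable_digitSum.analyticAt s).add
        ((Finset.analyticAt_fun_sum _ fun j _ => ?_).add hT))
    refine ((differentiable_shiftCoeff hb0 _).analyticAt s).mul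
      (AnalyticAt.fun_comp (f := fun s : ℂ => s + (j + 1 : ℕ)) (ih j fun k => ?_) (by fun_prop))
    simpa only [Nat.cast_add, add_assoc] using hs (j + 1 + k)

theorem analyticAt_continuation_neg_natCast (hA : ∀ a ∈ A, a < b) (hN : 1 < A.card)
    (hNb : A.card < b) (m : ℕ) : AnalyticAt ℂ (continuation b A) (-(m : ℂ)) := by
  refine analyticAt_continuation hA (Finset.card_pos.1 (by positivity)) (hN.trans hNb) _ fun k => ?_
  exact_mod_cast one_sub_card_mul_cpow_intCast_ne_zero hN hNb (-(m : ℤ) + k)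

theorem isContinuation_toMeromorphicNFOn (hA : ∀ a ∈ A, a < b) (hA0 : A.Nonempty) (hb : 1 < b) :
    IsContinuation b A (toMeromorphicNFOn (continuation b A) Set.univ) where
  meromorphic := meromorphicNFOn_toMeromorphicNFOn _ _
  hasSum s hs := by
    rw [(toMeromorphicNFOn_eventuallyEq_of_analyticAt
      (fun z _ => meromorphicAt_continuation hA hA0 hb z) (Set.mem_univ s)
      (analyticAt_continuation_of_lt hA hA0 hb hs)).eq_of_nhds, continuation_of_lt hs]
    exact (lseriesSummable_coeff hA hA0 hb hs).LSeriesHasSum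

namespace IsContinuation

variable {K K' : ℂ → ℂ}

theorem unique (hK : IsContinuation b A K) (hK' : IsContinuation b A K') : K = K' := by
  refine Set.eqOn_univ _ _ |>.1 (eqOn_of_meromorphicNFOn_of_eventuallyEq hK.meromorphic
    hK'.meromorphic isPreconnected_univ
    (Set.mem_univ ((Real.logb b A.card + 1 : ℝ) : ℂ)) ?_)
  filter_upwards [eventually_lt_re (by simp : Real.logb b A.card < (_ : ℂ).re)] with s hs
  rw [← (hK.hasSum s hs).LSeries_eq, (hK'.hasSum s hs).LSeries_eq]

theorem eventuallyEq (hK : IsContinuation b A K) (hA : ∀ a ∈ A, a < b) (hA0 : A.Nonempty)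
    (hb : 1 < b) {s : ℂ} (hs : AnalyticAt ℂ (continuation b A) s) :
    K =ᶠ[𝓝 s] continuation b A := by
  rw [hK.unique (isContinuation_toMeromorphicNFOn hA hA0 hb)]
  exact toMeromorphicNFOn_eventuallyEq_of_analyticAt
    (fun z _ => meromorphicAt_continuation hA hA0 hb z) (Set.mem_univ s) hs

end IsContinuation

end Continuation

section Values

theorem shiftCoeff_neg_natCast (hb : b ≠ 0) (m j : ℕ) :
    shiftCoeff b A (-(m : ℂ)) j = (b : ℂ) ^ m * (m.choose j * (powerSum A j / (b : ℂ) ^ j)) := by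
  have hb0 : (b : ℂ) ≠ 0 := Nat.cast_ne_zero.2 hb
  rw [shiftCoeff, neg_neg, Ring.choose_natCast, neg_add, neg_neg, Complex.cpow_add _ _ hb0,
    Complex.cpow_neg, Complex.cpow_natCast, Complex.cpow_natCast]
  ring

theorem digitSum_neg_natCast (m : ℕ) : digitSum A (-(m : ℂ)) = powerSum (A.erase 0) m := by
  simp only [digitSum, powerSum, neg_neg, Complex.cpow_natCast]

theorem powerSum_erase_zero {m : ℕ} (hm : m ≠ 0) : powerSum (A.erase 0) m = powerSum A m :=
  Finset.sum_erase A (by simp [hm])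

theorem neg_natCast_add_eq {m j : ℕ} (hj : j ≤ m) : -(m : ℂ) + j = -((m - j : ℕ) : ℂ) := by
  push_cast [hj]
  ring

theorem continuation_neg_natCast (hA : ∀ a ∈ A, a < b) (hN : 1 < A.card) (hNb : A.card < b)
    (m : ℕ) :
    (1 / (b : ℂ) ^ m - A.card) * continuation b A (-(m : ℂ)) =
      powerSum (A.erase 0) m / (b : ℂ) ^ m + ∑ j ∈ Finset.Icc 1 m, (m.choose j : ℂ) *
        (powerSum A j / (b : ℂ) ^ j) * continuation b A (-(m : ℂ) + j) := by
  have hb : b ≠ 0 := Nat.ne_zero_of_lt hNb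
  have hbm : (b : ℂ) ^ m ≠ 0 := pow_ne_zero m (Nat.cast_ne_zero.2 hb)
  have hne : 1 - (A.card : ℂ) * (b : ℂ) ^ m ≠ 0 := by
    simpa using one_sub_card_mul_cpow_intCast_ne_zero hN hNb (-(m : ℤ))
  have h := continuation_eq hA (Finset.card_pos.1 (by positivity)) (hN.trans hNb) (-(m : ℂ))
  have hsum : ∑' j : ℕ, shiftCoeff b A (-(m : ℂ)) (j + 1) *
      continuation b A (-(m : ℂ) + (j + 1 : ℕ)) = (b : ℂ) ^ m * ∑ j ∈ Finset.Icc 1 m,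
        (m.choose j : ℂ) * (powerSum A j / (b : ℂ) ^ j) * continuation b A (-(m : ℂ) + j) := by
    rw [← Finset.Ico_add_one_right_eq_Icc, Finset.sum_Ico_eq_sum_range, Nat.add_sub_cancel,
      Finset.mul_sum, tsum_eq_sum fun j hj => ?_]
    · refine Finset.sum_congr rfl fun j _ => ?_
      rw [shiftCoeff_neg_natCast hb, add_comm 1 j]
      ring
    · rw [shiftCoeff_neg_natCast hb, Nat.choose_eq_zero_of_lt
        (Nat.lt_succ_of_le (by simpa using hj))]
      simp
  rw [neg_neg, Complex.cpow_natCast, eq_inv_mul_iff_mul_eq₀ hne, digitSum_neg_natCast, hsum] at h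
  apply mul_left_cancel₀ hbm
  rw [mul_add, ← mul_assoc, mul_sub, mul_one_div_cancel hbm, mul_div_cancel₀ _ hbm, ← h]
  ring

theorem inv_natCast_pow_ne_natCast (hb : 1 ≤ b) {N : ℕ} (hN : 1 < N) (m : ℕ) :
    ((b : ℂ)⁻¹) ^ m ≠ N := by
  intro h
  have hnorm : ((b : ℝ)⁻¹) ^ m = N := by simpa using congrArg norm h
  have hle : ((b : ℝ)⁻¹) ^ m ≤ 1 :=
    pow_le_one₀ (by positivity) (inv_le_one_of_one_le₀ (by exact_mod_cast hb))
  have hlt : (1 : ℝ) < N := by exact_mod_cast hN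
  linarith

theorem coeff_alphaSeries (m : ℕ) :
    PowerSeries.coeff m (alphaSeries A) = powerSum A m / m.factorial := by
  simp [alphaSeries, powerSum, PowerSeries.coeff_rescale, PowerSeries.coeff_exp, Finset.sum_mul,
    div_eq_mul_inv]

theorem constantCoeff_rescale_alphaSeries (c : ℂ) :
    PowerSeries.constantCoeff (PowerSeries.rescale c (alphaSeries A)) = A.card := by
  rw [← PowerSeries.coeff_zero_eq_constantCoeff_apply, PowerSeries.coeff_rescale,
    coeff_alphaSeries]
  simp [powerSum]

theorem alphaSeries_erase_zero (h0 : 0 ∈ A) : alphaSeries (A.erase 0) = alphaSeries A - 1 := by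
  rw [alphaSeries, Finset.sum_erase_eq_sub h0, alphaSeries]
  simp

theorem eq_of_rescale_eq_add_alphaSeries_mul (hN : 1 < A.card) (hb : 1 ≤ b)
    {E F F' : PowerSeries ℂ}
    (hF : PowerSeries.rescale ((b : ℂ)⁻¹) F =
      E + PowerSeries.rescale ((b : ℂ)⁻¹) (alphaSeries A) * F)
    (hF' : PowerSeries.rescale ((b : ℂ)⁻¹) F' =
      E + PowerSeries.rescale ((b : ℂ)⁻¹) (alphaSeries A) * F') : F = F' :=
  eq_of_rescale_eq_add_mul (fun m => by
    rw [constantCoeff_rescale_alphaSeries]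
    exact inv_natCast_pow_ne_natCast hb hN m) hF hF'

namespace IsContinuation

variable {K : ℂ → ℂ}

theorem analyticAt_neg_natCast (hK : IsContinuation b A K) (hA : ∀ a ∈ A, a < b)
    (hN : 1 < A.card) (hNb : A.card < b) (m : ℕ) : AnalyticAt ℂ K (-(m : ℂ)) :=
  have h := analyticAt_continuation_neg_natCast hA hN hNb m
  h.congr (hK.eventuallyEq hA (Finset.card_pos.1 (by positivity)) (hN.trans hNb) h).symm

theorem apply_neg_natCast_eq_continuation (hK : IsContinuation b A K) (hA : ∀ a ∈ A, a < b)
    (hN : 1 < A.card) (hNb : A.card < b) (m : ℕ) :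
    K (-(m : ℂ)) = continuation b A (-(m : ℂ)) :=
  (hK.eventuallyEq hA (Finset.card_pos.1 (by positivity)) (hN.trans hNb)
    (analyticAt_continuation_neg_natCast hA hN hNb m)).eq_of_nhds

theorem recurrence_erase_zero (hK : IsContinuation b A K) (hA : ∀ a ∈ A, a < b)
    (hN : 1 < A.card) (hNb : A.card < b) (m : ℕ) :
    (1 / (b : ℂ) ^ m - A.card) * K (-(m : ℂ)) =
      powerSum (A.erase 0) m / (b : ℂ) ^ m + ∑ j ∈ Finset.Icc 1 m, (m.choose j : ℂ) *
        (powerSum A j / (b : ℂ) ^ j) * K (-(m : ℂ) + j) := by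
  have heq := hK.apply_neg_natCast_eq_continuation hA hN hNb
  rw [heq, continuation_neg_natCast hA hN hNb]
  refine congrArg _ (Finset.sum_congr rfl fun j hj => ?_)
  rw [neg_natCast_add_eq (Finset.mem_Icc.1 hj).2, heq]

theorem recurrence (hK : IsContinuation b A K) (hA : ∀ a ∈ A, a < b) (hN : 1 < A.card)
    (hNb : A.card < b) {m : ℕ} (hm : m ≠ 0) :
    (1 / (b : ℂ) ^ m - A.card) * K (-(m : ℂ)) =
      powerSum A m / (b : ℂ) ^ m + ∑ j ∈ Finset.Icc 1 m, (m.choose j : ℂ) *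
        (powerSum A j / (b : ℂ) ^ j) * K (-(m : ℂ) + j) := by
  rw [hK.recurrence_erase_zero hA hN hNb, powerSum_erase_zero hm]

theorem exists_rat (hK : IsContinuation b A K) (hA : ∀ a ∈ A, a < b) (hN : 1 < A.card)
    (hNb : A.card < b) (m : ℕ) : ∃ q : ℚ, K (-(m : ℂ)) = q := by
  suffices h : K (-(m : ℂ)) ∈ (algebraMap ℚ ℂ).fieldRange from
    have ⟨q, hq⟩ := h
    ⟨q, hq.symm⟩
  have hpow (n j : ℕ) : (n : ℂ) ^ j ∈ (algebraMap ℚ ℂ).fieldRange := pow_mem (natCast_mem _ _) _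
  have hpowerSum (B : Finset ℕ) (j : ℕ) : powerSum B j ∈ (algebraMap ℚ ℂ).fieldRange :=
    sum_mem fun a _ => hpow a j
  induction m using Nat.strong_induction_on with
  | _ m ih =>
    have hne : 1 / (b : ℂ) ^ m - A.card ≠ 0 := by
      rw [sub_ne_zero, one_div, ← inv_pow]
      exact inv_natCast_pow_ne_natCast (hN.trans hNb).le hN m
    rw [eq_div_of_mul_eq hne ((mul_comm _ _).trans (hK.recurrence_erase_zero hA hN hNb m))]
    refine div_mem (add_mem (div_mem (hpowerSum _ m) (hpow b m)) (sum_mem fun j hj => ?_))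
      (sub_mem (div_mem (one_mem _) (hpow b m)) (natCast_mem _ _))
    obtain ⟨hj1, hjm⟩ := Finset.mem_Icc.1 hj
    rw [neg_natCast_add_eq hjm]
    exact mul_mem (mul_mem (natCast_mem _ _) (div_mem (hpowerSum A j) (hpow b j)))
      (ih _ (by omega))

theorem apply_zero (hK : IsContinuation b A K) (hA : ∀ a ∈ A, a < b) (hN : 1 < A.card)
    (hNb : A.card < b) : K 0 = -((A.erase 0).card : ℂ) / ((A.card : ℂ) - 1) := by
  have h : (1 - (A.card : ℂ)) * K 0 = (A.erase 0).card := by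
    simpa [powerSum] using hK.recurrence_erase_zero hA hN hNb 0
  have hne : (A.card : ℂ) - 1 ≠ 0 := sub_ne_zero.2 (by exact_mod_cast hN.ne')
  rw [eq_div_iff hne]
  linear_combination -h

theorem apply_zero_of_zero_mem (hK : IsContinuation b A K) (hA : ∀ a ∈ A, a < b)
    (hN : 1 < A.card) (hNb : A.card < b) (h0 : 0 ∈ A) : K 0 = -1 := by
  have hne : (A.card : ℂ) - 1 ≠ 0 := sub_ne_zero.2 (by exact_mod_cast hN.ne')
  rw [hK.apply_zero hA hN hNb, Finset.cast_card_erase_of_mem h0, neg_div, div_self hne]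

theorem re_apply_zero_lt_of_zero_notMem (hK : IsContinuation b A K) (hA : ∀ a ∈ A, a < b)
    (hN : 1 < A.card) (hNb : A.card < b) (h0 : 0 ∉ A) : (K 0).re < -1 := by
  have hcard : (1 : ℝ) < A.card := by exact_mod_cast hN
  have hreal : K 0 = ((-(A.card : ℝ) / (A.card - 1) : ℝ) : ℂ) := by
    rw [hK.apply_zero hA hN hNb, Finset.erase_eq_of_notMem h0]
    push_cast
    rfl
  rw [hreal, Complex.ofReal_re, div_lt_iff₀ (by linarith)]
  linarith

theorem zero_mem_iff_apply_zero_eq (hK : IsContinuation b A K) (hA : ∀ a ∈ A, a < b)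
    (hN : 1 < A.card) (hNb : A.card < b) : 0 ∈ A ↔ K 0 = -1 := by
  refine ⟨hK.apply_zero_of_zero_mem hA hN hNb, fun h => by_contra fun h0 => ?_⟩
  simpa [h] using hK.re_apply_zero_lt_of_zero_notMem hA hN hNb h0

theorem zero_notMem_iff_re_apply_zero_lt (hK : IsContinuation b A K) (hA : ∀ a ∈ A, a < b)
    (hN : 1 < A.card) (hNb : A.card < b) : 0 ∉ A ↔ (K 0).re < -1 := by
  refine ⟨hK.re_apply_zero_lt_of_zero_notMem hA hN hNb, fun h h0 => ?_⟩
  simp [hK.apply_zero_of_zero_mem hA hN hNb h0] at h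

theorem apply_neg_natCast_div_pow (hK : IsContinuation b A K) (hA : ∀ a ∈ A, a < b)
    (hN : 1 < A.card) (hNb : A.card < b) (m : ℕ) :
    K (-(m : ℂ)) / (b : ℂ) ^ m = powerSum (A.erase 0) m / (b : ℂ) ^ m +
      ∑ j ∈ Finset.range (m + 1), (m.choose j : ℂ) * (powerSum A j / (b : ℂ) ^ j) *
        K (-((m - j : ℕ) : ℂ)) := by
  have hsum : ∑ j ∈ Finset.range (m + 1), (m.choose j : ℂ) * (powerSum A j / (b : ℂ) ^ j) *
      K (-((m - j : ℕ) : ℂ)) = A.card * K (-(m : ℂ)) + ∑ j ∈ Finset.Icc 1 m,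
        (m.choose j : ℂ) * (powerSum A j / (b : ℂ) ^ j) * K (-(m : ℂ) + j) := by
    rw [Finset.range_eq_Ico, Finset.sum_eq_sum_Ico_succ_bot m.add_one_pos, zero_add,
      Finset.Ico_add_one_right_eq_Icc]
    congr 1
    · simp [powerSum]
    · exact Finset.sum_congr rfl fun j hj => by rw [neg_natCast_add_eq (Finset.mem_Icc.1 hj).2]
  rw [hsum]
  linear_combination hK.recurrence_erase_zero hA hN hNb m

theorem rescale_egf_eq_erase_zero (hK : IsContinuation b A K) (hA : ∀ a ∈ A, a < b)
    (hN : 1 < A.card) (hNb : A.card < b) :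
    PowerSeries.rescale ((b : ℂ)⁻¹) (egf K) =
      PowerSeries.rescale ((b : ℂ)⁻¹) (alphaSeries (A.erase 0)) +
        PowerSeries.rescale ((b : ℂ)⁻¹) (alphaSeries A) * egf K := by
  ext m
  have hfactorial (n : ℕ) : (n.factorial : ℂ) ≠ 0 := Nat.cast_ne_zero.2 n.factorial_ne_zero
  rw [map_add, PowerSeries.coeff_mul, Finset.Nat.sum_antidiagonal_eq_sum_range_succ_mk]
  simp only [PowerSeries.coeff_rescale, coeff_alphaSeries, egf, PowerSeries.coeff_mk, inv_pow]
  calc ((b : ℂ) ^ m)⁻¹ * (K (-(m : ℂ)) / m.factorial)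
      = K (-(m : ℂ)) / (b : ℂ) ^ m / m.factorial := by ring
    _ = ((b : ℂ) ^ m)⁻¹ * (powerSum (A.erase 0) m / m.factorial) +
        ∑ j ∈ Finset.range (m + 1), (m.choose j : ℂ) * (powerSum A j / (b : ℂ) ^ j) *
          K (-((m - j : ℕ) : ℂ)) / m.factorial := by
        rw [hK.apply_neg_natCast_div_pow hA hN hNb, add_div, Finset.sum_div]
        ring
    _ = _ := by
        congr 1
        refine Finset.sum_congr rfl fun j hj => ?_
        rw [Nat.cast_choose ℂ (Finset.mem_range_succ_iff.1 hj)]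
        field_simp [hfactorial]

theorem rescale_egf_eq (hK : IsContinuation b A K) (hA : ∀ a ∈ A, a < b) (hN : 1 < A.card)
    (hNb : A.card < b) (h0 : 0 ∉ A) :
    PowerSeries.rescale ((b : ℂ)⁻¹) (egf K) =
      PowerSeries.rescale ((b : ℂ)⁻¹) (alphaSeries A) +
        PowerSeries.rescale ((b : ℂ)⁻¹) (alphaSeries A) * egf K := by
  simpa only [Finset.erase_eq_of_notMem h0] using hK.rescale_egf_eq_erase_zero hA hN hNb

theorem egf_eq_neg_one (hK : IsContinuation b A K) (hA : ∀ a ∈ A, a < b) (hN : 1 < A.card)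
    (hNb : A.card < b) (h0 : 0 ∈ A) : egf K = -1 := by
  refine eq_of_rescale_eq_add_alphaSeries_mul hN (hN.trans hNb).le
    (hK.rescale_egf_eq_erase_zero hA hN hNb) ?_
  rw [alphaSeries_erase_zero h0, map_neg, map_sub, map_one]
  ring

theorem apply_neg_natCast_of_zero_mem (hK : IsContinuation b A K) (hA : ∀ a ∈ A, a < b)
    (hN : 1 < A.card) (hNb : A.card < b) (h0 : 0 ∈ A) {m : ℕ} (hm : m ≠ 0) :
    K (-(m : ℂ)) = 0 := by
  have h := congrArg (PowerSeries.coeff m) (hK.egf_eq_neg_one hA hN hNb h0)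
  simpa [egf, PowerSeries.coeff_one, hm, Nat.factorial_ne_zero] using h

end IsContinuation

end Values

section GeneratingFunction

theorem term_zero (t : ℂ) : term b A 0 t = 1 := by simp [term]

theorem term_succ (k : ℕ) (t : ℂ) :
    term b A (k + 1) t = (alpha A (t / b))⁻¹ * term b A k (t / b) := by
  have hprod (k : ℕ) (t : ℂ) : ∏ j ∈ Finset.Icc 1 k, alpha A (t / (b : ℂ) ^ j) =
      ∏ j ∈ Finset.range k, alpha A (t / (b : ℂ) ^ (j + 1)) := by
    rw [← Finset.Ico_add_one_right_eq_Icc, Finset.prod_Ico_eq_prod_range, Nat.add_sub_cancel]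
    simp only [add_comm 1]
  rw [term, term, hprod, hprod, Finset.prod_range_succ', one_div, one_div, mul_inv, mul_comm]
  simp only [zero_add, pow_one, div_div, ← pow_succ']

theorem differentiable_alpha : Differentiable ℂ (alpha A) := by
  unfold alpha
  fun_prop

theorem eventually_forall_lt_norm_alpha_div_pow (hb : 1 ≤ b) {r : ℝ} (hr : r < A.card) :
    ∀ᶠ t in 𝓝 (0 : ℂ), ∀ j : ℕ, r < ‖alpha A (t / (b : ℂ) ^ j)‖ := by
  have hzero : r < ‖alpha A 0‖ := by simpa [alpha] using hr
  obtain ⟨δ, hδ, hball⟩ := Metric.eventually_nhds_iff_ball.1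
    (differentiable_alpha.continuous.norm.continuousAt.eventually_const_lt hzero)
  filter_upwards [Metric.ball_mem_nhds 0 hδ] with t ht j
  refine hball _ (mem_ball_zero_iff.2 (lt_of_le_of_lt ?_ (mem_ball_zero_iff.1 ht)))
  rw [norm_div, norm_pow, Complex.norm_natCast]
  exact div_le_self (norm_nonneg t) (one_le_pow₀ (by exact_mod_cast hb))

theorem norm_term_le_pow {q : ℝ} (hq : 0 < q) {t : ℂ}
    (h : ∀ j : ℕ, q⁻¹ < ‖alpha A (t / (b : ℂ) ^ j)‖) (k : ℕ) : ‖term b A k t‖ ≤ q ^ k := by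
  rw [term, norm_div, norm_one, norm_prod, one_div]
  refine inv_le_of_inv_le₀ (by positivity) ?_
  calc (q ^ k)⁻¹ = ∏ _j ∈ Finset.Icc 1 k, q⁻¹ := by simp
    _ ≤ ∏ j ∈ Finset.Icc 1 k, ‖alpha A (t / (b : ℂ) ^ j)‖ := by
      gcongr
      exact (h _).le

theorem differentiableAt_term {t : ℂ} (h : ∀ j : ℕ, alpha A (t / (b : ℂ) ^ j) ≠ 0) (k : ℕ) :
    DifferentiableAt ℂ (term b A k) t :=
  (differentiableAt_const 1).fun_div
    (DifferentiableAt.fun_finsetProd fun _ _ =>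
      (differentiable_alpha _).fun_comp' t (by fun_prop))
    (Finset.prod_ne_zero_iff.2 fun j _ => h j)

theorem one_lt_norm_natCast (hb : 1 < b) : 1 < ‖(b : ℂ)‖ := by
  rw [Complex.norm_natCast]
  exact_mod_cast hb

theorem exists_norm_term_le_mul_pow (hb : 1 < b) {q : ℝ} (hq : 0 < q) (hqN : q⁻¹ < A.card)
    (t : ℂ) : ∃ c : ℝ, ∀ k : ℕ, ‖term b A k t‖ ≤ c * q ^ k := by
  induction t using forall_of_eventually_of_forall_div (one_lt_norm_natCast hb) with
  | hzero =>
    filter_upwards [eventually_forall_lt_norm_alpha_div_pow hb.le hqN] with t ht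
    exact ⟨1, fun k => by simpa using norm_term_le_pow hq ht k⟩
  | hstep t ih =>
    obtain ⟨c, hc⟩ := ih
    refine ⟨max 1 (‖(alpha A (t / b))⁻¹‖ * c / q), fun k => ?_⟩
    rcases k with _ | k
    · simp [term_zero]
    · calc ‖term b A (k + 1) t‖ = ‖(alpha A (t / b))⁻¹‖ * ‖term b A k (t / b)‖ := by
            rw [term_succ, norm_mul]
        _ ≤ ‖(alpha A (t / b))⁻¹‖ * (c * q ^ k) := by
            gcongr
            exact hc k
        _ = ‖(alpha A (t / b))⁻¹‖ * c / q * q ^ (k + 1) := by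
            rw [pow_succ]
            field_simp
        _ ≤ max 1 (‖(alpha A (t / b))⁻¹‖ * c / q) * q ^ (k + 1) := by
            gcongr
            exact le_max_right _ _

theorem exists_lt_one_inv_lt_card (hN : 1 < A.card) :
    ∃ q : ℝ, 0 < q ∧ q < 1 ∧ q⁻¹ < A.card := by
  obtain ⟨r, hr, hrN⟩ := exists_between (show (1 : ℝ) < A.card by exact_mod_cast hN)
  exact ⟨r⁻¹, by positivity, inv_lt_one_of_one_lt₀ hr, by rwa [inv_inv]⟩

theorem exists_norm_term_le_geometric (hb : 1 < b) (hN : 1 < A.card) (t : ℂ) :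
    ∃ c q : ℝ, 0 < q ∧ q < 1 ∧ ∀ k : ℕ, ‖term b A k t‖ ≤ c * q ^ k := by
  obtain ⟨q, hq, hq1, hqN⟩ := exists_lt_one_inv_lt_card hN
  obtain ⟨c, hc⟩ := exists_norm_term_le_mul_pow hb hq hqN t
  exact ⟨c, q, hq, hq1, hc⟩

theorem summable_term (hb : 1 < b) (hN : 1 < A.card) (t : ℂ) :
    Summable fun k => term b A k t := by
  obtain ⟨c, q, hq, hq1, hc⟩ := exists_norm_term_le_geometric hb hN t
  exact Summable.of_norm_bounded ((summable_geometric_of_lt_one hq.le hq1).mul_left c) hc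

/-- The pointwise sum `-1 - ∑_{k ≥ 1} 1 / ∏_{j = 1}^k α_A(b ^ (-j) t)`, which represents the
exponential generating function. On `exceptionalSet b A` its values are meaningless. -/
noncomputable def egfSum (b : ℕ) (A : Finset ℕ) (t : ℂ) : ℂ := -1 - ∑' k, term b A (k + 1) t

/- Valid also where `alpha A (t / b) = 0`: by `0⁻¹ = 0` both sides are then `-1`. -/
theorem egfSum_eq (hb : 1 < b) (hN : 1 < A.card) (t : ℂ) :
    egfSum b A t = (alpha A (t / b))⁻¹ * egfSum b A (t / b) - 1 := by
  have h := (summable_term hb hN (t / b)).tsum_eq_zero_add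
  rw [term_zero] at h
  rw [egfSum, egfSum]
  simp only [term_succ _ t, tsum_mul_left, h]
  ring

theorem egfSum_div (hb : 1 < b) (hN : 1 < A.card) {t : ℂ} (ht : alpha A (t / b) ≠ 0) :
    egfSum b A (t / b) = alpha A (t / b) + alpha A (t / b) * egfSum b A t := by
  rw [egfSum_eq hb hN t]
  field_simp
  ring

theorem analyticAt_egfSum_zero (hb : 1 ≤ b) (hN : 1 < A.card) : AnalyticAt ℂ (egfSum b A) 0 := by
  obtain ⟨q, hq, hq1, hqN⟩ := exists_lt_one_inv_lt_card hN
  obtain ⟨U, hU, hopen, h0⟩ :=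
    eventually_nhds_iff.1 (eventually_forall_lt_norm_alpha_div_pow hb hqN)
  have hdiff : DifferentiableOn ℂ (fun t => ∑' k, term b A (k + 1) t) U :=
    Complex.differentiableOn_tsum_of_summable_norm
      ((summable_nat_add_iff 1).2 (summable_geometric_of_lt_one hq.le hq1))
      (fun k t ht => (differentiableAt_term (fun j => norm_pos_iff.1
        ((inv_pos.2 hq).trans (hU t ht j))) _).differentiableWithinAt) hopen
      fun k t ht => norm_term_le_pow hq (hU t ht) (k + 1)
  exact (hdiff.const_sub (-1)).analyticAt (hopen.mem_nhds h0)

theorem meromorphicAt_egfSum (hb : 1 < b) (hN : 1 < A.card) (t : ℂ) :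
    MeromorphicAt (egfSum b A) t := by
  induction t using forall_of_eventually_of_forall_div (one_lt_norm_natCast hb) with
  | hzero =>
    exact (analyticAt_egfSum_zero hb.le hN).eventually_analyticAt.mono fun t ht => ht.meromorphicAt
  | hstep t ih =>
    rw [funext (egfSum_eq (A := A) hb hN)]
    exact ((MeromorphicAt.comp_analyticAt (g := fun t : ℂ => t / b)
      (differentiable_alpha.analyticAt _).meromorphicAt (by fun_prop)).inv.mul
      (MeromorphicAt.comp_analyticAt (g := fun t : ℂ => t / b) ih (by fun_prop))).sub
      (MeromorphicAt.const 1 t)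

theorem div_notMem_exceptionalSet (hb : b ≠ 0) {t : ℂ} (ht : t ∉ exceptionalSet b A) :
    t / b ∉ exceptionalSet b A := by
  rintro ⟨j, hj, z, hz, heq⟩
  refine ht ⟨j + 1, hj.trans j.le_succ, z, hz, ?_⟩
  rw [(div_eq_iff (Nat.cast_ne_zero.2 hb)).1 heq]
  ring

theorem alpha_div_ne_zero (hb : b ≠ 0) {t : ℂ} (ht : t ∉ exceptionalSet b A) :
    alpha A (t / b) ≠ 0 := fun hz =>
  ht ⟨1, le_rfl, t / b, hz, by rw [pow_one, mul_div_cancel₀ _ (Nat.cast_ne_zero.2 hb)]⟩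

theorem analyticAt_egfSum (hb : 1 < b) (hN : 1 < A.card) {t : ℂ} (ht : t ∉ exceptionalSet b A) :
    AnalyticAt ℂ (egfSum b A) t := by
  have hb0 : b ≠ 0 := Nat.ne_zero_of_lt hb
  induction t using forall_of_eventually_of_forall_div (one_lt_norm_natCast hb) with
  | hzero => exact (analyticAt_egfSum_zero hb.le hN).eventually_analyticAt.mono fun t h _ => h
  | hstep t ih =>
    rw [funext (egfSum_eq (A := A) hb hN)]
    exact (((AnalyticAt.fun_comp (f := fun t : ℂ => t / b)
      (differentiable_alpha.analyticAt _) (by fun_prop)).inv (alpha_div_ne_zero hb0 ht)).mul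
      (AnalyticAt.fun_comp (f := fun t : ℂ => t / b)
        (ih (div_notMem_exceptionalSet hb0 ht)) (by fun_prop))).sub analyticAt_const

theorem taylorSeries_alpha : taylorSeries (alpha A) = alphaSeries A := by
  ext m
  rw [coeff_alphaSeries, taylorSeries, PowerSeries.coeff_mk]
  unfold alpha
  rw [iteratedDeriv_fun_sum fun a _ => by fun_prop]
  simp [powerSum, iteratedDeriv_cexp_const_mul]

theorem rescale_taylorSeries_egfSum (hb : 1 < b) (hN : 1 < A.card) :
    PowerSeries.rescale ((b : ℂ)⁻¹) (taylorSeries (egfSum b A)) =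
      PowerSeries.rescale ((b : ℂ)⁻¹) (alphaSeries A) +
        PowerSeries.rescale ((b : ℂ)⁻¹) (alphaSeries A) * taylorSeries (egfSum b A) := by
  have hnear : (fun t => egfSum b A ((b : ℂ)⁻¹ * t)) =ᶠ[𝓝 0] fun t =>
      alpha A ((b : ℂ)⁻¹ * t) + alpha A ((b : ℂ)⁻¹ * t) * egfSum b A t := by
    filter_upwards [eventually_forall_lt_norm_alpha_div_pow (A := A) hb.le
      (Nat.cast_pos.2 (zero_lt_one.trans hN))] with t ht
    have hne : alpha A (t / b) ≠ 0 := by simpa using ht 1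
    simpa only [inv_mul_eq_div] using egfSum_div hb hN hne
  have halpha : ContDiffAt ℂ ∞ (fun t => alpha A ((b : ℂ)⁻¹ * t)) 0 :=
    (differentiable_alpha.contDiff.comp (by fun_prop)).contDiffAt
  have hsum : ContDiffAt ℂ ∞ (egfSum b A) 0 := (analyticAt_egfSum_zero hb.le hN).contDiffAt
  rw [← taylorSeries_alpha, ← taylorSeries_comp_mul_left, ← taylorSeries_comp_mul_left,
    ← taylorSeries_mul halpha hsum, ← taylorSeries_add halpha (halpha.mul hsum)]
  exact taylorSeries_congr hnear

/-- The meromorphic extension of the exponential generating function, in normal form. -/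
noncomputable def egfContinuation (b : ℕ) (A : Finset ℕ) : ℂ → ℂ :=
  toMeromorphicNFOn (egfSum b A) Set.univ

theorem meromorphicNFOn_egfContinuation : MeromorphicNFOn (egfContinuation b A) Set.univ :=
  meromorphicNFOn_toMeromorphicNFOn _ _

theorem egfContinuation_eventuallyEq (hb : 1 < b) (hN : 1 < A.card) {t : ℂ}
    (ht : AnalyticAt ℂ (egfSum b A) t) : egfContinuation b A =ᶠ[𝓝 t] egfSum b A :=
  toMeromorphicNFOn_eventuallyEq_of_analyticAt (fun t _ => meromorphicAt_egfSum hb hN t)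
    (Set.mem_univ t) ht

theorem egfContinuation_eq (hb : 1 < b) (hN : 1 < A.card) {t : ℂ}
    (ht : t ∉ exceptionalSet b A) : egfContinuation b A t = egfSum b A t :=
  (egfContinuation_eventuallyEq hb hN (analyticAt_egfSum hb hN ht)).eq_of_nhds

theorem analyticAt_egfContinuation (hb : 1 < b) (hN : 1 < A.card) {t : ℂ}
    (ht : t ∉ exceptionalSet b A) : AnalyticAt ℂ (egfContinuation b A) t :=
  have h := analyticAt_egfSum hb hN ht
  h.congr (egfContinuation_eventuallyEq hb hN h).symm

theorem egfContinuation_div (hb : 1 < b) (hN : 1 < A.card) {t : ℂ}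
    (ht : t ∉ exceptionalSet b A) :
    egfContinuation b A (t / b) = alpha A (t / b) + alpha A (t / b) * egfContinuation b A t := by
  have hb0 : b ≠ 0 := Nat.ne_zero_of_lt hb
  rw [egfContinuation_eq hb hN ht, egfContinuation_eq hb hN (div_notMem_exceptionalSet hb0 ht),
    egfSum_div hb hN (alpha_div_ne_zero hb0 ht)]

theorem exists_hasSum_term_egfContinuation_eq (hb : 1 < b) (hN : 1 < A.card) {t : ℂ}
    (ht : t ∉ exceptionalSet b A) :
    ∃ S : ℂ, HasSum (fun k => term b A (k + 1) t) S ∧ egfContinuation b A t = -1 - S :=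
  ⟨_, ((summable_nat_add_iff 1).2 (summable_term hb hN t)).hasSum, egfContinuation_eq hb hN ht⟩

namespace IsContinuation

variable {K : ℂ → ℂ}

theorem egf_eq_taylorSeries (hK : IsContinuation b A K) (hA : ∀ a ∈ A, a < b) (hN : 1 < A.card)
    (hNb : A.card < b) (h0 : 0 ∉ A) : egf K = taylorSeries (egfSum b A) :=
  eq_of_rescale_eq_add_alphaSeries_mul hN (hN.trans hNb).le (hK.rescale_egf_eq hA hN hNb h0)
    (rescale_taylorSeries_egfSum (hN.trans hNb) hN)

theorem exists_hasSum_egfContinuation (hK : IsContinuation b A K) (hA : ∀ a ∈ A, a < b)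
    (hN : 1 < A.card) (hNb : A.card < b) (h0 : 0 ∉ A) :
    ∃ r : ℝ, 0 < r ∧ ∀ t : ℂ, ‖t‖ < r →
      HasSum (fun m : ℕ => K (-(m : ℂ)) * (t ^ m / m.factorial)) (egfContinuation b A t) := by
  have hb : 1 < b := hN.trans hNb
  have hzero := analyticAt_egfSum_zero hb.le hN
  have hnear := egfContinuation_eventuallyEq hb hN hzero
  obtain ⟨r, hr, hsum⟩ := exists_hasSum_coeff_taylorSeries (hzero.congr hnear.symm)
  refine ⟨r, hr, fun t ht => (hsum t ht).congr_fun fun m => ?_⟩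
  rw [taylorSeries_congr hnear, ← hK.egf_eq_taylorSeries hA hN hNb h0, egf, PowerSeries.coeff_mk]
  ring

end IsContinuation

end GeneratingFunction

end RestrictedDirichlet

theorem mainTheorem5 (b : ℕ) (A : Finset ℕ) (hA : ∀ a ∈ A, a < b)
    (hN : 1 < A.card) (hNb : A.card < b) :
    (∃ K : ℂ → ℂ, RestrictedDirichlet.IsContinuation b A K) ∧
    ∀ K : ℂ → ℂ, RestrictedDirichlet.IsContinuation b A K →
      -- the values are genuine (no poles) and rational
      (∀ m : ℕ, AnalyticAt ℂ K (-(m : ℂ))) ∧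
      (∀ m : ℕ, ∃ q : ℚ, K (-(m : ℂ)) = (q : ℂ)) ∧
      K 0 = -((A.erase 0).card : ℂ) / ((A.card : ℂ) - 1) ∧
      -- the recurrence
      (∀ m : ℕ, 1 ≤ m →
        (1 / (b : ℂ) ^ m - (A.card : ℂ)) * K (-(m : ℂ)) =
          RestrictedDirichlet.powerSum A m / (b : ℂ) ^ m +
            ∑ j ∈ Finset.Icc 1 m, (m.choose j : ℂ) *
              (RestrictedDirichlet.powerSum A j / (b : ℂ) ^ j) * K (-(m : ℂ) + (j : ℂ))) ∧
      -- the two cases and their equivalent descriptions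
      (0 ∈ A ↔ K 0 = -1) ∧
      (0 ∉ A ↔ (A.erase 0).card = A.card) ∧
      (0 ∉ A ↔ (K 0).re < -1) ∧
      (0 ∈ A → ∀ m : ℕ, 1 ≤ m → K (-(m : ℂ)) = 0) ∧
      (0 ∉ A →
        -- the functional equation for formal power series
        PowerSeries.rescale ((b : ℂ)⁻¹) (RestrictedDirichlet.egf K) =
          PowerSeries.rescale ((b : ℂ)⁻¹) (RestrictedDirichlet.alphaSeries A) +
            PowerSeries.rescale ((b : ℂ)⁻¹) (RestrictedDirichlet.alphaSeries A) *
              RestrictedDirichlet.egf K ∧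
        ∃ C : ℂ → ℂ, MeromorphicNFOn C Set.univ ∧
          -- positive radius of convergence, with sum `C` near `0`
          (∃ r : ℝ, 0 < r ∧ ∀ t : ℂ, ‖t‖ < r →
            HasSum (fun m : ℕ => K (-(m : ℂ)) * (t ^ m / (m.factorial : ℂ))) (C t)) ∧
          ∀ t : ℂ, t ∉ RestrictedDirichlet.exceptionalSet b A →
            AnalyticAt ℂ C t ∧
            -- the functional equation for the meromorphic function
            C (t / (b : ℂ)) = RestrictedDirichlet.alpha A (t / (b : ℂ)) +
              RestrictedDirichlet.alpha A (t / (b : ℂ)) * C t ∧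
            -- the explicit series, which converges geometrically
            (∃ S : ℂ, HasSum (fun k : ℕ => RestrictedDirichlet.term b A (k + 1) t) S ∧
              C t = -1 - S) ∧
            ∃ c q : ℝ, 0 < q ∧ q < 1 ∧
              ∀ k : ℕ, 1 ≤ k → ‖RestrictedDirichlet.term b A k t‖ ≤ c * q ^ k) := by
  have hb : 1 < b := hN.trans hNb
  refine ⟨⟨_, RestrictedDirichlet.isContinuation_toMeromorphicNFOn hA
    (Finset.card_pos.1 (by positivity)) hb⟩, fun K hK => ?_⟩
  have hcard : 0 ∉ A ↔ (A.erase 0).card = A.card :=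
    ⟨fun h => by rw [Finset.erase_eq_of_notMem h],
      fun h h0 => (Finset.card_erase_lt_of_mem h0).ne h⟩
  refine ⟨hK.analyticAt_neg_natCast hA hN hNb, hK.exists_rat hA hN hNb, hK.apply_zero hA hN hNb,
    fun m hm => hK.recurrence hA hN hNb (Nat.one_le_iff_ne_zero.1 hm),
    hK.zero_mem_iff_apply_zero_eq hA hN hNb, hcard,
    hK.zero_notMem_iff_re_apply_zero_lt hA hN hNb,
    fun h0 m hm => hK.apply_neg_natCast_of_zero_mem hA hN hNb h0 (Nat.one_le_iff_ne_zero.1 hm),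
    fun h0 => ⟨hK.rescale_egf_eq hA hN hNb h0, RestrictedDirichlet.egfContinuation b A,
      RestrictedDirichlet.meromorphicNFOn_egfContinuation,
      hK.exists_hasSum_egfContinuation hA hN hNb h0, fun t ht => ?_⟩⟩
  obtain ⟨c, q, hq, hq1, hc⟩ := RestrictedDirichlet.exists_norm_term_le_geometric hb hN t
  exact ⟨RestrictedDirichlet.analyticAt_egfContinuation hb hN ht,
    RestrictedDirichlet.egfContinuation_div hb hN ht,
    RestrictedDirichlet.exists_hasSum_term_egfContinuation_eq hb hN ht,
    c, q, hq, hq1, fun k _ => hc k⟩
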